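/- Let $P$ be the regular dodecahedron and $\Gamma$ its edge graph, and equip the set $P^{(0)}$ of its $20$ vertices with the combinatorial distance, that is, the path metric of $\Gamma$. For $r \ge 0$ let $\operatorname{VR}_{\le r}$ be the simplicial complex whose simplices are the non-empty subsets of $P^{(0)}$ of diameter at most $r$. A partial matching on a simplicial complex $C$ is a relation $\sigma \nearrow \tau$ on its simplices such that $\sigma$ is a codimension-one face of $\tau$ whenever $\sigma \nearrow \tau$, and such that every simplex occurs in at most one pair; simplices that occur in a pair are called matched, the others critical. It is acyclic if the Hasse diagram of the face poset of $C$, with the edge between a simplex and a codimension-one face of it directed upwards if the pair is matched and downwards otherwise, has no directed cycle. There are exactly ten $3$-simplices $\tau_1, \dots, \tau_{10}$ (sets of four vertices of $P$) any two of whose vertices have distance $3$, and: 1. There is an acyclic partial matching on $\operatorname{VR}_{\le 3}$ that matches only simplices of diameter $3$, and such that the critical simplices of diameter $3$ are precisely $\tau_1, \dots, \tau_{10}$. 2. Removing the simplices $\tau_1, \dots, \tau_{10}$ from $\operatorname{VR}_{\le 3}$ leaves a subcomplex $\operatorname{VR}_{\le 3} \setminus \{\tau_1, \dots, \tau_{10}\}$,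 and its geometric realization strongly deformation retracts onto that of $\operatorname{VR}_{\le 2}$ (that is, by a homotopy that fixes every point of $\operatorname{VR}_{\le 2}$ throughout). -/

import Mathlib

open scoped goldenRatio

/-! ### Vietoris-Rips complexes of graphs with respect to the combinatorial distance -/

/-- The diameter of a finite set of vertices of a graph `G`, with respect to the combinatorial
distance (least number of edges of a path, `⊤` if there is no path). -/
noncomputable def combDiam {V : Type*} (G : SimpleGraph V) (F : Finset V) : ℕ∞ :=
  F.sup fun u => F.sup fun v => G.edist u v

/-- The Vietoris-Rips complex `VR_{≤ r}` of the vertex set of `G` with the combinatorial distance: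
its simplices are the nonempty finite sets of vertices of diameter at most `r`. -/
noncomputable def vietorisRips {V : Type*} (G : SimpleGraph V) (r : ℕ) :
    PreAbstractSimplicialComplex V where
  faces := {F | F.Nonempty ∧ combDiam G F ≤ r}
  isRelLowerSet_faces := fun {_} hF =>
    ⟨hF.1, fun _ hsub hne =>
      ⟨hne, le_trans ((Finset.sup_mono_fun fun _ _ => Finset.sup_mono hsub).trans
        (Finset.sup_mono hsub)) hF.2⟩⟩

/-! ### Combinatorial Morse theory -/

/-- `σ` is a facet of `τ`: a face of codimension one. -/
def IsFacetOf {V : Type*} (σ τ : Finset V) : Prop :=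
  σ ⊆ τ ∧ τ.card = σ.card + 1

/-- The relation `M` (read `M σ τ` as `σ ↗ τ`) is a partial matching on the simplices of `C`:
paired simplices are a facet and its cofacet, and every simplex has at most one partner. -/
structure IsPartialMatching {V : Type*} (C : PreAbstractSimplicialComplex V)
    (M : Finset V → Finset V → Prop) : Prop where
  mem_left : ∀ σ τ, M σ τ → σ ∈ C.faces
  mem_right : ∀ σ τ, M σ τ → τ ∈ C.faces
  isFacetOf : ∀ σ τ, M σ τ → IsFacetOf σ τ
  partner_unique : ∀ σ ρ ρ', (M σ ρ ∨ M ρ σ) → (M σ ρ' ∨ M ρ' σ) → ρ = ρ'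

/-- The simplex `σ` is matched by `M`. The simplices that are not matched are the critical ones. -/
def IsMatched {V : Type*} (M : Finset V → Finset V → Prop) (σ : Finset V) : Prop :=
  ∃ τ, M σ τ ∨ M τ σ

/-- The Hasse diagram of `C` directed by the matching `M`: the edge between a simplex and one of
its facets points up if the pair is matched and down if it is not. -/
def HasseStep {V : Type*} (C : PreAbstractSimplicialComplex V)
    (M : Finset V → Finset V → Prop) (σ τ : Finset V) : Prop :=
  σ ∈ C.faces ∧ τ ∈ C.faces ∧
    ((IsFacetOf σ τ ∧ M σ τ) ∨ (IsFacetOf τ σ ∧ ¬ M τ σ))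

/-- The matching `M` on `C` is acyclic: the directed Hasse diagram has no directed cycle. -/
def IsAcyclicMatching {V : Type*} (C : PreAbstractSimplicialComplex V)
    (M : Finset V → Finset V → Prop) : Prop :=
  ∀ σ, ¬ Relation.TransGen (HasseStep C M) σ σ

/-! ### Geometric realization and deformation retractions -/

/-- The geometric realization of a simplicial complex on a finite vertex set `V`: the union, inside
the standard simplex in `ℝ^V`, of the closed simplices spanned by the faces of `K`. -/
def realization {V : Type*} [Fintype V] (K : PreAbstractSimplicialComplex V) : Set (V → ℝ) :=
  {x | x ∈ stdSimplex ℝ V ∧ ∃ σ ∈ K.faces, ∀ v, v ∉ σ → x v = 0}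

/-- The subspace `X` strongly deformation retracts onto its subspace `A`: the identity of `X` is
homotopic, by a homotopy fixing every point of `A` at all times, to a map with values in `A`. -/
def StronglyDeformationRetracts {E : Type*} [TopologicalSpace E] (X A : Set E) : Prop :=
  A ⊆ X ∧ ∃ r : C(X, X), (∀ x, (r x : E) ∈ A) ∧
    (ContinuousMap.id X).HomotopicRel r {x : X | (x : E) ∈ A}

/-! ### The dodecahedron -/

/-- The twenty vertices of the regular dodecahedron, as points of three-dimensional space. -/
noncomputable def dodecahedronVertex : Fin 20 → EuclideanSpace ℝ (Fin 3) :=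
  ![!₂[1, 1, 1], !₂[1, 1, -1], !₂[1, -1, 1], !₂[1, -1, -1],
    !₂[-1, 1, 1], !₂[-1, 1, -1], !₂[-1, -1, 1], !₂[-1, -1, -1],
    !₂[0, φ⁻¹, φ], !₂[0, φ⁻¹, -φ], !₂[0, -φ⁻¹, φ], !₂[0, -φ⁻¹, -φ],
    !₂[φ⁻¹, φ, 0], !₂[φ⁻¹, -φ, 0], !₂[-φ⁻¹, φ, 0], !₂[-φ⁻¹, -φ, 0],
    !₂[φ, 0, φ⁻¹], !₂[φ, 0, -φ⁻¹], !₂[-φ, 0, φ⁻¹], !₂[-φ, 0, -φ⁻¹]]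

/-- The solid regular dodecahedron. -/
noncomputable def dodecahedron : Set (EuclideanSpace ℝ (Fin 3)) :=
  convexHull ℝ (Set.range dodecahedronVertex)

/-- The edge graph of the dodecahedron: two distinct vertices are adjacent if the segment between
them is an edge, that is, an (exposed) face, of the polytope. -/
def dodecahedronGraph : SimpleGraph (Fin 20) where
  Adj i j := i ≠ j ∧
    IsExposed ℝ dodecahedron (segment ℝ (dodecahedronVertex i) (dodecahedronVertex j))
  symm := ⟨fun _ _ h => ⟨h.1.symm, by rw [segment_symm]; exact h.2⟩⟩
  loopless := ⟨fun _ h => h.1 rfl⟩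

/-- The tetrahedra on vertices of the dodecahedron any two of whose vertices have combinatorial
distance three. -/
def distanceThreeTetrahedra : Set (Finset (Fin 20)) :=
  {σ | σ.card = 4 ∧ ∀ u ∈ σ, ∀ v ∈ σ, u ≠ v → dodecahedronGraph.edist u v = 3}

/-! ### Unions of acyclic matchings -/

section Matchings

variable {V : Type*}

/-! Both claims follow from one sequence of elementary reductions. Suppose that adding a vertex `v`
outside `σ` to any simplex containing `σ` gives a simplex again. Then the open star of `σ` can be
removed. Combinatorially, toggling `v` pairs off all its members, acyclically
(`IsStarCollapse.potential_lt`). Geometrically, moving mass from `σ` to `v` retracts the realization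
onto what is left (`IsStarCollapse.stronglyDeformationRetracts`). Both effects compose along a
sequence of removals, so such a sequence from the Rips complex without the ten tetrahedra down to
diameter two proves both claims.

Combinatorial distance becomes computable through the Gram matrix over `ℤ[φ]`: the edges of the
polytope are the pairs with inner product `√5`, and the inner product determines the distance
(`dodecahedronGraph_edist`). Complexes are then encoded by lists of nonfaces, removing a star means
adding a nonface, and the explicit sequence `starSequence` is verified by evaluation
(`checkStarCollapses_starSequence`). The tetrahedra are maximal simplices, so putting them back as
critical simplices adds only downward steps to the Hasse diagram. -/

theorem PreAbstractSimplicialComplex.mem_of_subset {K : PreAbstractSimplicialComplex V}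
    {s t : Finset V} (ht : t ∈ K.faces) (hst : s ⊆ t) (hs : s.Nonempty) : s ∈ K.faces :=
  (K.isRelLowerSet_faces ht).2 hst hs

theorem PreAbstractSimplicialComplex.nonempty_of_mem {K : PreAbstractSimplicialComplex V}
    {s : Finset V} (hs : s ∈ K.faces) : s.Nonempty :=
  (K.isRelLowerSet_faces hs).1

theorem IsPartialMatching.union {K L : PreAbstractSimplicialComplex V}
    {M N : Finset V → Finset V → Prop} (hLK : L.faces ⊆ K.faces)
    (hM : IsPartialMatching L M) (hN : IsPartialMatching K N)
    (hNL : ∀ a b, N a b → a ∉ L.faces ∧ b ∉ L.faces) :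
    IsPartialMatching K fun a b => M a b ∨ N a b where
  mem_left a b h := h.elim (fun h => hLK (hM.mem_left a b h)) (hN.mem_left a b)
  mem_right a b h := h.elim (fun h => hLK (hM.mem_right a b h)) (hN.mem_right a b)
  isFacetOf a b h := h.elim (hM.isFacetOf a b) (hN.isFacetOf a b)
  partner_unique a b c hb hc := by
    have hML : ∀ a b, M a b ∨ M b a → a ∈ L.faces := fun a b h =>
      h.elim (hM.mem_left a b) (hM.mem_right b a)
    have hNL' : ∀ a b, N a b ∨ N b a → a ∉ L.faces := fun a b h =>
      h.elim (fun h => (hNL a b h).1) (fun h => (hNL b a h).2)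
    have hb' : (M a b ∨ M b a) ∨ (N a b ∨ N b a) := by tauto
    have hc' : (M a c ∨ M c a) ∨ (N a c ∨ N c a) := by tauto
    rcases hb' with hb' | hb' <;> rcases hc' with hc' | hc'
    · exact hM.partner_unique a b c hb' hc'
    · exact absurd (hML _ _ hb') (hNL' _ _ hc')
    · exact absurd (hML _ _ hc') (hNL' _ _ hb')
    · exact hN.partner_unique a b c hb' hc'

/-- A directed path that enters `L` never leaves it: `L` is closed under faces and `N` does not
touch it. Acyclicity can therefore be tested separately on `L` and on its complement. Strictly
decreasing potentials serve as certificates of acyclicity that are easy to glue. -/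
theorem exists_potential_union [Finite V] {K L : PreAbstractSimplicialComplex V}
    {M N : Finset V → Finset V → Prop} {f g : Finset V → ℕ}
    (hM : IsPartialMatching L M)
    (hNL : ∀ a b, N a b → a ∉ L.faces ∧ b ∉ L.faces)
    (hf : ∀ a b, HasseStep L M a b → f b < f a)
    (hg : ∀ a b, a ∉ L.faces → b ∉ L.faces → HasseStep K N a b → g b < g a) :
    ∃ h : Finset V → ℕ, ∀ a b, HasseStep K (fun a b => M a b ∨ N a b) a b → h b < h a := by
  classical
  obtain ⟨B, hB⟩ := (Set.finite_range f).bddAbove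
  have hB' : ∀ a, f a ≤ B := fun a => hB ⟨a, rfl⟩
  -- The shift by `B + 1` puts every simplex outside `L` above all of `L`.
  refine ⟨fun a => if a ∈ L.faces then f a else B + 1 + g a, fun a b hab => ?_⟩
  obtain ⟨haK, hbK, hab⟩ := hab
  by_cases ha : a ∈ L.faces
  · have hstep : b ∈ L.faces ∧ HasseStep L M a b := by
      rcases hab with ⟨hfac, hm | hn⟩ | ⟨hfac, hn⟩
      · exact ⟨hM.mem_right _ _ hm, ha, hM.mem_right _ _ hm, Or.inl ⟨hfac, hm⟩⟩
      · exact absurd ha (hNL _ _ hn).1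
      · have hb := L.mem_of_subset ha hfac.1 (K.nonempty_of_mem hbK)
        exact ⟨hb, ha, hb, Or.inr ⟨hfac, fun h => hn (Or.inl h)⟩⟩
    simpa [ha, hstep.1] using hf a b hstep.2
  · by_cases hb : b ∈ L.faces
    · have := hB' b
      simp only [ha, hb, if_true, if_false]
      omega
    · have := hg a b ha hb ⟨haK, hbK, by
        rcases hab with ⟨hfac, hm | hn⟩ | ⟨hfac, hn⟩
        · exact absurd (hM.mem_left _ _ hm) ha
        · exact Or.inl ⟨hfac, hn⟩
        · exact Or.inr ⟨hfac, fun h => hn (Or.inr h)⟩⟩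
      simp only [ha, hb, if_false]
      omega

theorem isAcyclicMatching_of_potential {K : PreAbstractSimplicialComplex V}
    {M : Finset V → Finset V → Prop} {f : Finset V → ℕ}
    (hf : ∀ a b, HasseStep K M a b → f b < f a) : IsAcyclicMatching K M := by
  have key : ∀ a b, Relation.TransGen (HasseStep K M) a b → f b < f a := fun a b h => by
    induction h with
    | single h => exact hf _ _ h
    | tail _ h ih => exact (hf _ _ h).trans ih
  exact fun a h => (key a a h).false

end Matchings

/-! ### Removing open stars -/

/-- `L` is obtained from `K` by removing the open star of `σ`, which is a cone with apex `v`
over the set of its members without `v`. -/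
structure IsStarCollapse {V : Type*} [DecidableEq V] (K L : PreAbstractSimplicialComplex V)
    (σ : Finset V) (v : V) : Prop where
  nonempty : σ.Nonempty
  notMem : v ∉ σ
  insert_mem : ∀ F ∈ K.faces, σ ⊆ F → insert v F ∈ K.faces
  faces_eq : L.faces = {F | F ∈ K.faces ∧ ¬ σ ⊆ F}

/-- `K` can be reduced to `L` by successively removing open stars that are cones. -/
inductive StarCollapses {V : Type*} [DecidableEq V] :
    PreAbstractSimplicialComplex V → PreAbstractSimplicialComplex V → Prop
  | refl (K : PreAbstractSimplicialComplex V) : StarCollapses K K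
  | step {K L L' : PreAbstractSimplicialComplex V} (σ : Finset V) (v : V)
      (h : IsStarCollapse K L σ v) (h' : StarCollapses L L') : StarCollapses K L'

section Collapses

variable {V : Type*} [DecidableEq V]

/-- The matching of the members of the open star of `σ` along the vertex `v`. -/
def starMatching (K : PreAbstractSimplicialComplex V) (σ : Finset V) (v : V)
    (a b : Finset V) : Prop :=
  a ∈ K.faces ∧ σ ⊆ a ∧ v ∉ a ∧ b = insert v a

namespace IsStarCollapse

variable {K L : PreAbstractSimplicialComplex V} {σ : Finset V} {v : V}

theorem faces_subset (h : IsStarCollapse K L σ v) : L.faces ⊆ K.faces := by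
  rw [h.faces_eq]; exact fun _ hF => hF.1

theorem subset_of_notMem (h : IsStarCollapse K L σ v) {F : Finset V} (hF : F ∈ K.faces)
    (hFL : F ∉ L.faces) : σ ⊆ F := by
  rw [h.faces_eq] at hFL
  by_contra hn
  exact hFL ⟨hF, hn⟩

theorem notMem_of_subset (h : IsStarCollapse K L σ v) {F : Finset V} (hF : σ ⊆ F) :
    F ∉ L.faces := by
  rw [h.faces_eq]; exact fun hFL => hFL.2 hF

theorem isPartialMatching (h : IsStarCollapse K L σ v) :
    IsPartialMatching K (starMatching K σ v) where
  mem_left _ _ hab := hab.1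
  mem_right a b hab := by
    obtain ⟨ha, hs, -, rfl⟩ := hab
    exact h.insert_mem a ha hs
  isFacetOf a b hab := by
    obtain ⟨-, -, hv, rfl⟩ := hab
    exact ⟨Finset.subset_insert _ _, Finset.card_insert_of_notMem hv⟩
  partner_unique a b c hb hc := by
    rcases hb with ⟨-, -, hv, rfl⟩ | ⟨-, -, hv, hb⟩ <;>
      rcases hc with ⟨-, -, hv', rfl⟩ | ⟨-, -, hv', hc⟩
    · rfl
    · subst hc; simp at hv
    · subst hb; simp at hv'
    · rw [← Finset.erase_insert hv, ← Finset.erase_insert hv', ← hb, ← hc]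

theorem notMem_of_starMatching (h : IsStarCollapse K L σ v) (a b : Finset V)
    (hab : starMatching K σ v a b) : a ∉ L.faces ∧ b ∉ L.faces := by
  obtain ⟨-, hs, -, rfl⟩ := hab
  exact ⟨h.notMem_of_subset hs, h.notMem_of_subset (hs.trans (Finset.subset_insert _ _))⟩

theorem isMatched_starMatching_iff (h : IsStarCollapse K L σ v) (a : Finset V) :
    IsMatched (starMatching K σ v) a ↔ a ∈ K.faces ∧ a ∉ L.faces := by
  constructor
  · rintro ⟨b, hab | hab⟩
    · exact ⟨hab.1, (h.notMem_of_starMatching _ _ hab).1⟩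
    · exact ⟨h.isPartialMatching.mem_right _ _ hab, (h.notMem_of_starMatching _ _ hab).2⟩
  · rintro ⟨ha, haL⟩
    have hs := h.subset_of_notMem ha haL
    by_cases hv : v ∈ a
    · have hs' : σ ⊆ a.erase v := fun u hu =>
        Finset.mem_erase.2 ⟨fun e => h.notMem (e ▸ hu), hs hu⟩
      exact ⟨a.erase v, Or.inr ⟨K.mem_of_subset ha (Finset.erase_subset _ _)
        (h.nonempty.mono hs'), hs', Finset.notMem_erase _ _, (Finset.insert_erase hv).symm⟩⟩
    · exact ⟨insert v a, Or.inl ⟨ha, hs, hv, rfl⟩⟩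

/-- A matched step up adds `v`, so it gains one in cardinality and loses the penalty `2`. An
unmatched step down within the star cannot remove `v`, since that pair is matched; hence it lowers
the cardinality at equal penalty. -/
theorem potential_lt (h : IsStarCollapse K L σ v) (a b : Finset V)
    (hb : b ∉ L.faces) (hab : HasseStep K (starMatching K σ v) a b) :
    (if v ∈ b then 0 else 2) + b.card < (if v ∈ a then 0 else 2) + a.card := by
  obtain ⟨-, hbK, ⟨-, -, -, hv, rfl⟩ | ⟨hfac, hn⟩⟩ := hab
  · rw [Finset.card_insert_of_notMem hv]
    simp [hv]
    omega
  · have hcard := hfac.2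
    by_cases hva : v ∈ a
    · have hvb : v ∈ b := by
        by_contra hvb
        refine hn ⟨hbK, h.subset_of_notMem hbK hb, hvb, ?_⟩
        symm
        apply Finset.eq_of_subset_of_card_le (Finset.insert_subset hva hfac.1)
        rw [Finset.card_insert_of_notMem hvb, hcard]
      simp only [hva, hvb, if_true]
      omega
    · have hvb : v ∉ b := fun hvb => hva (hfac.1 hvb)
      simp only [hva, hvb, if_false]
      omega

end IsStarCollapse

theorem StarCollapses.exists_matching [Finite V] {K L : PreAbstractSimplicialComplex V}
    (h : StarCollapses K L) :
    L.faces ⊆ K.faces ∧ ∃ (M : Finset V → Finset V → Prop) (f : Finset V → ℕ),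
      IsPartialMatching K M ∧ (∀ a b, HasseStep K M a b → f b < f a) ∧
      ∀ a, IsMatched M a ↔ a ∈ K.faces ∧ a ∉ L.faces := by
  induction h with
  | refl K =>
    refine ⟨subset_rfl, fun _ _ => False, Finset.card, ⟨by simp, by simp, by simp, by simp⟩,
      ?_, by simp [IsMatched]⟩
    rintro a b ⟨-, -, ⟨-, h⟩ | ⟨h, -⟩⟩
    · exact h.elim
    · have := h.2
      omega
  | @step K L L' σ v h _ ih =>
    obtain ⟨hsub, M, f, hM, hf, hmatch⟩ := ih
    obtain ⟨g, hg⟩ := exists_potential_union hM h.notMem_of_starMatching hf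
      fun a b _ hb hab => h.potential_lt a b hb hab
    refine ⟨hsub.trans h.faces_subset, _, g,
      hM.union h.faces_subset h.isPartialMatching h.notMem_of_starMatching, hg, fun a => ?_⟩
    have hor : IsMatched (fun a b => M a b ∨ starMatching K σ v a b) a ↔
        IsMatched M a ∨ IsMatched (starMatching K σ v) a := by
      simp only [IsMatched, ← exists_or]
      exact exists_congr fun _ => by tauto
    rw [hor, hmatch, h.isMatched_starMatching_iff]
    have h1 : a ∈ L'.faces → a ∈ L.faces := fun ha => hsub ha
    have h2 : a ∈ L.faces → a ∈ K.faces := fun ha => h.faces_subset ha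
    tauto

end Collapses

/-! ### Deformation retractions -/

theorem StronglyDeformationRetracts.refl {E : Type*} [TopologicalSpace E] (X : Set E) :
    StronglyDeformationRetracts X X :=
  ⟨subset_rfl, ContinuousMap.id X, fun x => x.2, ContinuousMap.HomotopicRel.refl _⟩

theorem StronglyDeformationRetracts.trans {E : Type*} [TopologicalSpace E] {X Y A : Set E}
    (hXY : StronglyDeformationRetracts X Y) (hYA : StronglyDeformationRetracts Y A) :
    StronglyDeformationRetracts X A := by
  obtain ⟨hYX, r, hr, ⟨F⟩⟩ := hXY
  obtain ⟨hAY, s, hs, ⟨G⟩⟩ := hYA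
  let r' : C(X, Y) := ⟨fun x => ⟨r x, hr x⟩, by fun_prop⟩
  let i : C(Y, X) := ⟨Set.inclusion hYX, continuous_inclusion hYX⟩
  have hfix : ∀ x : X, (x : E) ∈ A → r x = x := fun x hx => (F.fst_eq_snd (hAY hx)).symm
  refine ⟨hAY.trans hYX, i.comp (s.comp r'), fun x => hs _, ?_⟩
  have h₁ : (ContinuousMap.id X).HomotopicRel r {x : X | (x : E) ∈ A} :=
    ⟨⟨F.toHomotopy, fun t x hx => F.prop t x (hAY hx)⟩⟩
  -- The second homotopy is run on the image of `r`. It fixes `A` because `r` is the identity there.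
  have h₂ : r.HomotopicRel (i.comp (s.comp r')) {x : X | (x : E) ∈ A} := by
    refine ⟨⟨⟨⟨fun p => i (G (p.1, r' p.2)), by fun_prop⟩, fun x => ?_, fun x => ?_⟩,
      fun t x hx => ?_⟩⟩
    · simp [i, r']
    · simp [i]
    · have hx' : ((r' x : Y) : E) ∈ A := by
        have : (r x : E) = x := congrArg Subtype.val (hfix x hx)
        change (r x : E) ∈ A
        rw [this]; exact hx
      have := G.eq_fst t hx'
      change i (G (t, r' x)) = r x
      rw [this]
      rfl
  exact h₁.trans h₂

theorem stronglyDeformationRetracts_of_homotopy {E : Type*} [TopologicalSpace E] {X A : Set E}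
    (hAX : A ⊆ X) (H : ℝ → E → E) (hH : Continuous fun p : ℝ × E => H p.1 p.2)
    (hmem : ∀ t ∈ Set.Icc (0 : ℝ) 1, ∀ x ∈ X, H t x ∈ X) (hzero : ∀ x ∈ X, H 0 x = x)
    (hone : ∀ x ∈ X, H 1 x ∈ A) (hfix : ∀ t, ∀ x ∈ A, H t x = x) :
    StronglyDeformationRetracts X A := by
  refine ⟨hAX, ⟨fun x => ⟨H 1 x, hmem 1 (by simp) x x.2⟩, ?_⟩, fun x => hone x x.2,
    ⟨⟨⟨⟨fun p => ⟨H p.1 p.2, hmem p.1 p.1.2 p.2 p.2.2⟩, ?_⟩, fun x => ?_, fun x => ?_⟩,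
      fun t x hx => ?_⟩⟩⟩
  · exact (hH.comp (by fun_prop : Continuous fun x : X => ((1 : ℝ), (x : E)))).subtype_mk _
  · exact (hH.comp (by fun_prop :
      Continuous fun p : unitInterval × X => ((p.1 : ℝ), (p.2 : E)))).subtype_mk _
  · exact Subtype.ext (hzero x x.2)
  · rfl
  · exact Subtype.ext (hfix t x hx)

/-! ### Pushing an open star towards its apex -/

section Realization

variable {V : Type*} [Fintype V] [DecidableEq V]

/-- The direction in which the open star of `σ` is pushed towards the vertex `v`. -/
def pushDirection (σ : Finset V) (v : V) : V → ℝ :=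
  fun u => if u = v then (σ.card : ℝ) else if u ∈ σ then -1 else 0

theorem sum_pushDirection {σ : Finset V} {v : V} (hv : v ∉ σ) :
    ∑ u, pushDirection σ v u = 0 := by
  have : ∀ u, pushDirection σ v u =
      (if u = v then (σ.card : ℝ) else 0) - (if u ∈ σ then 1 else 0) := by
    intro u
    by_cases h : u = v
    · subst h; simp [pushDirection, hv]
    · by_cases h' : u ∈ σ <;> simp [pushDirection, h, h']
  simp [this, Finset.sum_sub_distrib]

/-- Let `m x` be the least coordinate of `x` on `σ`. At time `t`, mass `t * m x` is moved from each
vertex of `σ` to `v`. As `m` vanishes on the realization of `L`, this single formula is continuous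
and fixes that subspace, so no gluing is needed. -/
theorem IsStarCollapse.stronglyDeformationRetracts {K L : PreAbstractSimplicialComplex V}
    {σ : Finset V} {v : V} (h : IsStarCollapse K L σ v) :
    StronglyDeformationRetracts (realization K) (realization L) := by
  set m : (V → ℝ) → ℝ := fun x => σ.inf' h.nonempty x with hm
  have hm_le : ∀ x, ∀ u ∈ σ, m x ≤ x u := fun x u hu => Finset.inf'_le x hu
  have hm_nonneg : ∀ x, x ∈ stdSimplex ℝ V → 0 ≤ m x := fun x hx =>
    Finset.le_inf' _ _ fun u _ => hx.1 u
  have hm_zero : ∀ x, x ∈ stdSimplex ℝ V → ∀ F : Finset V, ¬ σ ⊆ F →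
      (∀ u, u ∉ F → x u = 0) → m x = 0 := by
    intro x hx F hF hxF
    obtain ⟨u, hu, huF⟩ := Finset.not_subset.1 hF
    exact le_antisymm ((hm_le x u hu).trans (hxF u huF).le) (hm_nonneg x hx)
  have hm_cont : Continuous m := by
    have := Continuous.finset_inf'_apply (f := fun (u : V) (x : V → ℝ) => x u) h.nonempty
      (fun u _ => continuous_apply u)
    exact this
  have hsimplex : ∀ t ∈ Set.Icc (0 : ℝ) 1, ∀ x ∈ stdSimplex ℝ V,
      x + (t * m x) • pushDirection σ v ∈ stdSimplex ℝ V := by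
    intro t ht x hx
    have h0 := hm_nonneg x hx
    refine ⟨fun u => ?_, ?_⟩
    · have hxu := hx.1 u
      have htm : 0 ≤ t * m x := mul_nonneg ht.1 h0
      simp only [Pi.add_apply, Pi.smul_apply, smul_eq_mul, pushDirection]
      split_ifs with h1 h2
      · positivity
      · have h3 := hm_le x u h2
        have h4 : t * m x ≤ m x := mul_le_of_le_one_left h0 ht.2
        linarith
      · simpa using hxu
    · simp [Finset.sum_add_distrib, ← Finset.mul_sum, sum_pushDirection h.notMem, hx.2]
  have hinsert : ∀ F : Finset V, σ ⊆ F → ∀ x : V → ℝ, (∀ u, u ∉ F → x u = 0) → ∀ c : ℝ,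
      ∀ u, u ∉ insert v F → (x + c • pushDirection σ v) u = 0 := by
    intro F hF x hx c u hu
    rw [Finset.mem_insert, not_or] at hu
    have : u ∉ σ := fun hs => hu.2 (hF hs)
    simp [pushDirection, hu.1, this, hx u hu.2]
  have hAX : realization L ⊆ realization K := fun x ⟨hx, F, hF, hxF⟩ =>
    ⟨hx, F, h.faces_subset hF, hxF⟩
  refine stronglyDeformationRetracts_of_homotopy hAX
    (fun t x => x + (t * m x) • pushDirection σ v) (by fun_prop) ?_ (by simp) ?_ ?_
  · rintro t ht x ⟨hx, F, hF, hxF⟩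
    refine ⟨hsimplex t ht x hx, ?_⟩
    by_cases hs : σ ⊆ F
    · exact ⟨insert v F, h.insert_mem F hF hs, hinsert F hs x hxF _⟩
    · exact ⟨F, hF, by simpa [hm_zero x hx F hs hxF] using hxF⟩
  · rintro x ⟨hx, F, hF, hxF⟩
    refine ⟨hsimplex 1 (by simp) x hx, ?_⟩
    by_cases hs : σ ⊆ F
    · obtain ⟨w, hw, hmw⟩ := Finset.exists_mem_eq_inf' h.nonempty x
      have hvw : v ≠ w := fun e => h.notMem (e ▸ hw)
      -- At time `1` the coordinate at `w`, where the minimum is attained, has become zero, so the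
      -- support no longer contains `σ`.
      refine ⟨(insert v F).erase w, ?_, fun u hu => ?_⟩
      · rw [h.faces_eq]
        refine ⟨K.mem_of_subset (h.insert_mem F hF hs) (Finset.erase_subset _ _)
          ⟨v, by simp [hvw]⟩, fun hsub => Finset.notMem_erase w _ (hsub hw)⟩
      · by_cases huw : u = w
        · subst huw
          have : m x = x u := hmw
          simp [pushDirection, hvw.symm, hw, this]
        · exact hinsert F hs x hxF _ u fun hmem => hu (Finset.mem_erase.2 ⟨huw, hmem⟩)
    · refine ⟨F, ?_, by simpa [hm_zero x hx F hs hxF] using hxF⟩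
      rw [h.faces_eq]
      exact ⟨hF, hs⟩
  · rintro t x ⟨hx, F, hF, hxF⟩
    rw [h.faces_eq] at hF
    simp [hm_zero x hx F hF.2 hxF]

theorem StarCollapses.stronglyDeformationRetracts {K L : PreAbstractSimplicialComplex V}
    (h : StarCollapses K L) : StronglyDeformationRetracts (realization K) (realization L) := by
  induction h with
  | refl K => exact StronglyDeformationRetracts.refl _
  | step σ v h _ ih => exact h.stronglyDeformationRetracts.trans ih

end Realization

/-! ### Gram matrix of the vertices -/

/-- The ring `ℤ[φ]` of golden integers. -/
abbrev GoldenInt := QuadraticAlgebra ℤ 1 1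

/-- The embedding of the golden integers into the real numbers. -/
noncomputable def goldenEval : GoldenInt →+* ℝ :=
  (QuadraticAlgebra.lift (R := ℤ) (a := 1) (b := 1) (A := ℝ)
    ⟨φ, by have := Real.goldenRatio_sq; simp; nlinarith⟩).toRingHom

theorem goldenEval_apply (x : GoldenInt) : goldenEval x = x.re + x.im * φ := by
  simp [goldenEval, QuadraticAlgebra.lift]

/-- The coordinates of the vertices of the dodecahedron as golden integers. -/
def goldenVertex : Fin 20 → Fin 3 → GoldenInt :=
  ![![1, 1, 1], ![1, 1, -1], ![1, -1, 1], ![1, -1, -1],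
    ![-1, 1, 1], ![-1, 1, -1], ![-1, -1, 1], ![-1, -1, -1],
    ![0, ⟨-1, 1⟩, ⟨0, 1⟩], ![0, ⟨-1, 1⟩, ⟨0, -1⟩], ![0, ⟨1, -1⟩, ⟨0, 1⟩], ![0, ⟨1, -1⟩, ⟨0, -1⟩],
    ![⟨-1, 1⟩, ⟨0, 1⟩, 0], ![⟨-1, 1⟩, ⟨0, -1⟩, 0], ![⟨1, -1⟩, ⟨0, 1⟩, 0], ![⟨1, -1⟩, ⟨0, -1⟩, 0],
    ![⟨0, 1⟩, 0, ⟨-1, 1⟩], ![⟨0, 1⟩, 0, ⟨1, -1⟩], ![⟨0, -1⟩, 0, ⟨-1, 1⟩], ![⟨0, -1⟩, 0, ⟨1, -1⟩]]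

theorem dodecahedronVertex_apply (i : Fin 20) (k : Fin 3) :
    dodecahedronVertex i k = goldenEval (goldenVertex i k) := by
  have h : (φ)⁻¹ = φ - 1 := by
    rw [Real.inv_goldenRatio]
    linarith [Real.goldenRatio_add_goldenConj]
  have hmk : ∀ a b : ℤ, goldenEval ⟨a, b⟩ = a + b * φ := fun a b => goldenEval_apply _
  fin_cases i <;> fin_cases k <;>
    simp [dodecahedronVertex, goldenVertex, h] <;> simp [hmk] <;> ring

/-- The inner products of the vertices of the dodecahedron as golden integers. -/
def goldenGram (i j : Fin 20) : GoldenInt := ∑ k, goldenVertex i k * goldenVertex j k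

theorem inner_dodecahedronVertex (i j : Fin 20) :
    inner ℝ (dodecahedronVertex i) (dodecahedronVertex j) = goldenEval (goldenGram i j) := by
  simp only [PiLp.inner_apply, dodecahedronVertex_apply, goldenGram, map_sum, map_mul]
  refine Finset.sum_congr rfl fun k _ => ?_
  simp [mul_comm]

/-- The combinatorial distance of two vertices of the dodecahedron, read off from their inner
product, which is one of `3`, `√5`, `1`, `-1`, `-√5`, `-3`. -/
def dodecahedronDist (i j : Fin 20) : ℕ :=
  if goldenGram i j = 3 then 0 else if goldenGram i j = ⟨-1, 2⟩ then 1
  else if goldenGram i j = 1 then 2 else if goldenGram i j = -1 then 3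
  else if goldenGram i j = ⟨1, -2⟩ then 4 else 5

theorem goldenGram_self : ∀ i, goldenGram i i = 3 := by decide +kernel

theorem goldenGram_of_ne : ∀ i j, i ≠ j →
    goldenGram i j ∈ ([⟨-1, 2⟩, 1, -1, ⟨1, -2⟩, -3] : List GoldenInt) := by
  decide +kernel

/-- The cone with apex the vertex `i` that is spanned by its edges contains all vertices. -/
theorem sum_edges_goldenVertex : ∀ i j, ∀ k,
    2 * (goldenVertex j k - goldenVertex i k) =
      ∑ n, if goldenGram i n = ⟨-1, 2⟩ then
        (goldenGram j n - ⟨0, 1⟩ * goldenGram j i + ⟨1, 1⟩) * (goldenVertex n k - goldenVertex i k)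
      else 0 := by
  decide +kernel

/-- As a function of the vertex `j`, the coefficient is affine, equals `2` at `n` and vanishes at
`i` and its other two neighbours. It thus vanishes on a facet plane and is nonnegative on the
polytope. Nonnegativity of both components suffices because `φ` is positive. -/
theorem edge_coefficient_nonneg : ∀ i j n, goldenGram i n = ⟨-1, 2⟩ →
    0 ≤ (goldenGram j n - ⟨0, 1⟩ * goldenGram j i + ⟨1, 1⟩).re ∧
    0 ≤ (goldenGram j n - ⟨0, 1⟩ * goldenGram j i + ⟨1, 1⟩).im := by
  decide +kernel

/-! ### The edge graph -/

theorem goldenEval_le_of_mem {x : GoldenInt}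
    (hx : x ∈ ([⟨-1, 2⟩, 1, -1, ⟨1, -2⟩, -3] : List GoldenInt)) :
    goldenEval x ≤ -1 + 2 * φ := by
  have := Real.one_lt_goldenRatio
  simp only [List.mem_cons, List.not_mem_nil, or_false] at hx
  rcases hx with rfl | rfl | rfl | rfl | rfl <;>
    simp only [goldenEval_apply, map_one, map_neg, map_ofNat] <;> push_cast <;> linarith

theorem inner_dodecahedronVertex_self (i : Fin 20) :
    inner ℝ (dodecahedronVertex i) (dodecahedronVertex i) = (3 : ℝ) := by
  rw [inner_dodecahedronVertex, goldenGram_self, map_ofNat]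

theorem inner_dodecahedronVertex_le {i j : Fin 20} (h : i ≠ j) :
    inner ℝ (dodecahedronVertex i) (dodecahedronVertex j) ≤ -1 + 2 * φ := by
  rw [inner_dodecahedronVertex]
  exact goldenEval_le_of_mem (goldenGram_of_ne i j h)

theorem isExposed_convexHull_segment {E ι : Type*} [NormedAddCommGroup E] [NormedSpace ℝ E]
    (p : ι → E) (l : E →L[ℝ] ℝ) {i j : ι} (hij : l (p i) = l (p j))
    (hlt : ∀ k, k ≠ i → k ≠ j → l (p k) < l (p i)) :
    IsExposed ℝ (convexHull ℝ (Set.range p)) (segment ℝ (p i) (p j)) := by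
  have hseg : ∀ x ∈ segment ℝ (p i) (p j), l x = l (p i) := by
    rintro x ⟨a, b, -, -, hab, rfl⟩
    rw [map_add, map_smul, map_smul, ← hij, ← add_smul, hab, one_smul]
  have hsub : segment ℝ (p i) (p j) ⊆ convexHull ℝ (Set.range p) :=
    (convex_convexHull ℝ _).segment_subset (subset_convexHull ℝ _ ⟨i, rfl⟩)
      (subset_convexHull ℝ _ ⟨j, rfl⟩)
  -- The right-hand side is convex because a proper convex combination attains the maximum of `l`
  -- only if both points do.
  have hhull : convexHull ℝ (Set.range p) ⊆ {x | l x < l (p i)} ∪ segment ℝ (p i) (p j) := by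
    refine convexHull_min ?_ ?_
    · rintro _ ⟨k, rfl⟩
      by_cases hi : k = i
      · subst hi; exact Or.inr (left_mem_segment ℝ _ _)
      by_cases hj : k = j
      · subst hj; exact Or.inr (right_mem_segment ℝ _ _)
      exact Or.inl (hlt k hi hj)
    · rw [convex_iff_forall_pos]
      have hle : ∀ x ∈ {x | l x < l (p i)} ∪ segment ℝ (p i) (p j), l x ≤ l (p i) :=
        fun x hx => hx.elim (fun h => le_of_lt h) fun h => (hseg x h).le
      intro x hx y hy a b ha hb hab
      by_cases hxy : x ∈ segment ℝ (p i) (p j) ∧ y ∈ segment ℝ (p i) (p j)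
      · exact Or.inr (convex_segment _ _ hxy.1 hxy.2 ha.le hb.le hab)
      · left
        have h1 := hle x hx
        have h2 := hle y hy
        have h3 : l x < l (p i) ∨ l y < l (p i) := by
          rcases hx with hx | hx
          · exact Or.inl hx
          · rcases hy with hy | hy
            · exact Or.inr hy
            · exact absurd ⟨hx, hy⟩ hxy
        simp only [Set.mem_ofPred_eq, map_add, map_smul, smul_eq_mul]
        obtain rfl : a = 1 - b := by linarith
        rcases h3 with h3 | h3
        · nlinarith [mul_pos ha (sub_pos.2 h3), mul_nonneg hb.le (sub_nonneg.2 h2)]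
        · nlinarith [mul_pos hb (sub_pos.2 h3), mul_nonneg ha.le (sub_nonneg.2 h1)]
  refine fun _ => ⟨l, Set.Subset.antisymm (fun x hx => ⟨hsub hx, fun y hy => ?_⟩) ?_⟩
  · rw [hseg x hx]
    exact (hhull hy).elim (fun h => le_of_lt h) fun h => (hseg y h).le
  · rintro x ⟨hx, hmax⟩
    refine (hhull hx).resolve_left fun h => ?_
    exact (lt_of_lt_of_le h (hmax _ (subset_convexHull ℝ _ ⟨i, rfl⟩))).false

/-- Otherwise the squared norm `3` would be an average of inner products that are at most `√5 = -1 +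
2 * φ < 3`. -/
theorem eq_or_eq_of_mem_segment {i j k : Fin 20}
    (h : dodecahedronVertex k ∈ segment ℝ (dodecahedronVertex i) (dodecahedronVertex j)) :
    k = i ∨ k = j := by
  by_contra! hk
  obtain ⟨a, b, ha, hb, hab, he⟩ := h
  have h3 := inner_dodecahedronVertex_self k
  nth_rewrite 2 [← he] at h3
  rw [inner_add_right, inner_smul_right, inner_smul_right] at h3
  have h1 := inner_dodecahedronVertex_le hk.1
  have h2 := inner_dodecahedronVertex_le hk.2
  have := Real.goldenRatio_lt_two
  obtain rfl : a = 1 - b := by linarith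
  nlinarith [mul_le_mul_of_nonneg_left h1 ha, mul_le_mul_of_nonneg_left h2 hb]

theorem sum_edges_dodecahedronVertex (i j : Fin 20) :
    (2 : ℝ) • (dodecahedronVertex j - dodecahedronVertex i) =
      ∑ n, if goldenGram i n = ⟨-1, 2⟩ then
        goldenEval (goldenGram j n - ⟨0, 1⟩ * goldenGram j i + ⟨1, 1⟩) •
          (dodecahedronVertex n - dodecahedronVertex i)
      else 0 := by
  ext k
  have := congrArg goldenEval (sum_edges_goldenVertex i j k)
  rw [map_sum] at this
  simp only [map_mul, map_sub, map_ofNat, apply_ite goldenEval, map_zero] at this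
  rw [PiLp.smul_apply, PiLp.sub_apply, WithLp.ofLp_sum, Finset.sum_apply, smul_eq_mul,
    dodecahedronVertex_apply, dodecahedronVertex_apply, this]
  refine Finset.sum_congr rfl fun n _ => ?_
  split_ifs
  · simp [dodecahedronVertex_apply]
  · rfl

/-- Let `l` expose the segment from `i` to `j`. If `j` were not among the three vertices `n` with
inner product `√5` to `i`, then `l` would be strictly smaller at each of these than at `i`. But `j -
i` is a nonnegative combination of the `n - i` on which `l` vanishes, so all coefficients are zero
and the two points coincide. -/
theorem goldenGram_eq_of_adj {i j : Fin 20} (h : dodecahedronGraph.Adj i j) :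
    goldenGram i j = ⟨-1, 2⟩ := by
  obtain ⟨hij, hexp⟩ := h
  by_contra hg
  obtain ⟨l, hl⟩ := hexp ⟨_, left_mem_segment ℝ _ _⟩
  have hmem : ∀ k, dodecahedronVertex k ∈ dodecahedron := fun k =>
    subset_convexHull ℝ _ ⟨k, rfl⟩
  have hi : ∀ y ∈ dodecahedron, l y ≤ l (dodecahedronVertex i) :=
    (hl ▸ left_mem_segment ℝ (dodecahedronVertex i) (dodecahedronVertex j) :
      dodecahedronVertex i ∈ {x ∈ dodecahedron | ∀ y ∈ dodecahedron, l y ≤ l x}).2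
  have hj : ∀ y ∈ dodecahedron, l y ≤ l (dodecahedronVertex j) :=
    (hl ▸ right_mem_segment ℝ (dodecahedronVertex i) (dodecahedronVertex j) :
      dodecahedronVertex j ∈ {x ∈ dodecahedron | ∀ y ∈ dodecahedron, l y ≤ l x}).2
  have hlt : ∀ n, goldenGram i n = ⟨-1, 2⟩ →
      l (dodecahedronVertex n) < l (dodecahedronVertex i) := by
    intro n hn
    refine lt_of_le_of_ne (hi _ (hmem n)) fun he => ?_
    have hseg : dodecahedronVertex n ∈
        segment ℝ (dodecahedronVertex i) (dodecahedronVertex j) := by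
      rw [hl]
      exact ⟨hmem n, fun y hy => he ▸ hi y hy⟩
    rcases eq_or_eq_of_mem_segment hseg with rfl | rfl
    · rw [goldenGram_self] at hn
      exact absurd hn (by decide)
    · exact hg hn
  have hsum := congrArg l (sum_edges_dodecahedronVertex i j)
  rw [map_smul, map_sub, le_antisymm (hi _ (hmem j)) (hj _ (hmem i)), sub_self, smul_zero,
    map_sum] at hsum
  have hcoef : ∀ n, goldenGram i n = ⟨-1, 2⟩ →
      0 ≤ goldenEval (goldenGram j n - ⟨0, 1⟩ * goldenGram j i + ⟨1, 1⟩) := by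
    intro n hn
    obtain ⟨h1, h2⟩ := edge_coefficient_nonneg i j n hn
    rw [goldenEval_apply]
    have := Real.goldenRatio_pos
    have h1' : (0 : ℝ) ≤ ((goldenGram j n - ⟨0, 1⟩ * goldenGram j i + ⟨1, 1⟩).re : ℤ) := by
      exact_mod_cast h1
    have h2' : (0 : ℝ) ≤ ((goldenGram j n - ⟨0, 1⟩ * goldenGram j i + ⟨1, 1⟩).im : ℤ) := by
      exact_mod_cast h2
    positivity
  have hzero := (Finset.sum_eq_zero_iff_of_nonpos fun n _ => by
    split_ifs with hn
    · rw [map_smul, smul_eq_mul, map_sub]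
      exact mul_nonpos_of_nonneg_of_nonpos (hcoef n hn) (sub_nonpos.2 (hlt n hn).le)
    · simp).1 hsum.symm
  have hvec : (2 : ℝ) • (dodecahedronVertex j - dodecahedronVertex i) = 0 := by
    rw [sum_edges_dodecahedronVertex]
    refine Finset.sum_eq_zero fun n hn => ?_
    have hz := hzero n hn
    split_ifs at hz ⊢ with hin
    · rw [map_smul, smul_eq_mul, map_sub] at hz
      rw [(mul_eq_zero.1 hz).resolve_right (sub_ne_zero.2 (hlt n hin).ne), zero_smul]
    · rfl
  have hv : dodecahedronVertex j = dodecahedronVertex i := by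
    simpa [sub_eq_zero] using hvec
  have hji : dodecahedronVertex j ∈
      segment ℝ (dodecahedronVertex i) (dodecahedronVertex i) := by
    rw [hv]; exact left_mem_segment ℝ _ _
  rcases eq_or_eq_of_mem_segment hji with e | e <;> exact hij e.symm

theorem adj_of_goldenGram_eq {i j : Fin 20} (h : goldenGram i j = ⟨-1, 2⟩) :
    dodecahedronGraph.Adj i j := by
  have hij : i ≠ j := by
    rintro rfl
    rw [goldenGram_self] at h
    exact absurd h (by decide)
  have hval : inner ℝ (dodecahedronVertex i) (dodecahedronVertex j) = -1 + 2 * φ := by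
    rw [inner_dodecahedronVertex, h, goldenEval_apply]
    push_cast
    ring
  -- The sum of the two endpoints defines the supporting functional: it equals `3 + √5` at both and
  -- is at most `2 * √5` at every other vertex.
  refine ⟨hij, isExposed_convexHull_segment dodecahedronVertex
    (innerSL ℝ (dodecahedronVertex i + dodecahedronVertex j)) ?_ fun k hki hkj => ?_⟩
  · simp only [innerSL_apply_apply, inner_add_left, inner_dodecahedronVertex_self, hval,
      real_inner_comm (dodecahedronVertex i) (dodecahedronVertex j)]
    rw [add_comm]
  · have h1 := inner_dodecahedronVertex_le hki.symm
    have h2 := inner_dodecahedronVertex_le hkj.symm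
    have := Real.goldenRatio_lt_two
    simp only [innerSL_apply_apply, inner_add_left, inner_dodecahedronVertex_self,
      real_inner_comm (dodecahedronVertex i) (dodecahedronVertex j), hval]
    linarith

theorem dodecahedronGraph_adj_iff (i j : Fin 20) :
    dodecahedronGraph.Adj i j ↔ goldenGram i j = ⟨-1, 2⟩ :=
  ⟨goldenGram_eq_of_adj, adj_of_goldenGram_eq⟩

/-- Predecessors build a walk of length `f u w`, while growth by at most one per edge bounds every
walk from below. Both conditions are local, hence decidable on a finite graph. -/
theorem SimpleGraph.edist_eq_of_forall_adj {V : Type*} (G : SimpleGraph V) (f : V → V → ℕ)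
    (hself : ∀ u, f u u = 0) (hadj : ∀ u v w, G.Adj v w → f u w ≤ f u v + 1)
    (hpred : ∀ u w, u ≠ w → ∃ v, G.Adj v w ∧ f u v + 1 = f u w) (u w : V) :
    G.edist u w = f u w := by
  have hle : ∀ n u w, f u w = n → G.edist u w ≤ n := by
    intro n
    induction n with
    | zero =>
      intro u w h
      by_cases huw : u = w
      · subst huw; simp
      · obtain ⟨v, -, hv⟩ := hpred u w huw
        omega
    | succ n ih =>
      intro u w h
      have huw : u ≠ w := by
        rintro rfl
        rw [hself] at h
        omega
      obtain ⟨v, hv, he⟩ := hpred u w huw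
      calc G.edist u w ≤ G.edist u v + G.edist v w := G.edist_triangle
        _ ≤ n + 1 := add_le_add (ih u v (by omega)) (SimpleGraph.edist_eq_one_iff_adj.2 hv).le
        _ = (n + 1 : ℕ) := by simp
  refine le_antisymm (hle _ u w rfl) ?_
  have hwalk : ∀ {v w : V} (p : G.Walk v w), f u w ≤ f u v + p.length := by
    intro v w p
    induction p with
    | nil => simp
    | @cons a b c hab p ih =>
      have := hadj u a b hab
      rw [SimpleGraph.Walk.length_cons]
      omega
  refine le_iInf fun p => ?_
  have := hwalk p
  rw [hself, zero_add] at this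
  exact_mod_cast this

theorem dodecahedronGraph_edist (i j : Fin 20) :
    dodecahedronGraph.edist i j = dodecahedronDist i j := by
  refine dodecahedronGraph.edist_eq_of_forall_adj dodecahedronDist ?_ ?_ ?_ i j
  · decide +kernel
  · simp only [dodecahedronGraph_adj_iff]
    decide +kernel
  · simp only [dodecahedronGraph_adj_iff]
    decide +kernel

/-! ### Complexes of vertices of the dodecahedron given by nonfaces -/

/-- The set of vertices whose indices are the positions of the binary digits `1` of `m`. -/
def bitSet (m : ℕ) : Finset (Fin 20) := Finset.univ.filter fun i => m.testBit i

theorem mem_bitSet {m : ℕ} {i : Fin 20} : i ∈ bitSet m ↔ m.testBit i = true := by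
  simp [bitSet]

theorem bitSet_subset_of_land_eq {m n : ℕ} (h : m &&& n = m) : bitSet m ⊆ bitSet n := by
  intro i hi
  rw [mem_bitSet] at hi ⊢
  rw [← h, Nat.testBit_land, Bool.and_eq_true] at hi
  exact hi.2

theorem bitSet_lor (m n : ℕ) : bitSet (m ||| n) = bitSet m ∪ bitSet n := by
  ext i
  simp [mem_bitSet]

theorem bitSet_xor_two_pow {m : ℕ} {v : Fin 20} (hv : v ∈ bitSet m) :
    bitSet (m ^^^ 2 ^ (v : ℕ)) = (bitSet m).erase v := by
  rw [mem_bitSet] at hv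
  ext i
  rw [Finset.mem_erase, mem_bitSet, mem_bitSet, Nat.testBit_xor, Nat.testBit_two_pow]
  by_cases h : v = i
  · subst h; simp [hv]
  · have : (v : ℕ) ≠ i := fun e => h (Fin.ext e)
    simp [this, Ne.symm h]

/-- The complex of the nonempty sets that contain none of the sets encoded in `B`. -/
def avoidingComplex (B : List ℕ) : PreAbstractSimplicialComplex (Fin 20) where
  faces := {F | F.Nonempty ∧ ∀ b ∈ B, ¬ bitSet b ⊆ F}
  isRelLowerSet_faces := fun {_} hF =>
    ⟨hF.1, fun _ hsub hne => ⟨hne, fun b hb h => hF.2 b hb (h.trans hsub)⟩⟩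

/-- Adding `s` to the nonfaces `B` removes an open star that is a cone with apex `v`. -/
def checkStarCollapse (B : List ℕ) (s : ℕ) (v : Fin 20) : Bool :=
  decide (s % 2 ^ 20 ≠ 0) && !s.testBit v && B.all fun b => !b.testBit v ||
    B.any fun c => c &&& (s ||| (b ^^^ 2 ^ (v : ℕ))) == c

/-- If adding `v` to a simplex `F` containing `s` created a nonface `b`, then `F` would contain `s`
together with `b` minus `v`, and hence the nonface `c` found by the check. Reduction modulo `2 ^ 20`
matters because `bitSet` ignores higher digits. -/
theorem isStarCollapse_of_check {B : List ℕ} {s : ℕ} {v : Fin 20}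
    (h : checkStarCollapse B s v = true) :
    IsStarCollapse (avoidingComplex B) (avoidingComplex (s :: B)) (bitSet s) v := by
  simp only [checkStarCollapse, Bool.and_eq_true, decide_eq_true_eq, Bool.not_eq_true',
    List.all_eq_true, Bool.or_eq_true, List.any_eq_true, beq_iff_eq] at h
  obtain ⟨⟨hs, hv⟩, hB⟩ := h
  refine ⟨?_, by simp [mem_bitSet, hv], fun F hF hsF => ⟨Finset.insert_nonempty _ _, ?_⟩, ?_⟩
  · obtain ⟨i, hi⟩ := Nat.exists_testBit_of_ne_zero hs
    rw [Nat.testBit_mod_two_pow, Bool.and_eq_true, decide_eq_true_eq] at hi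
    exact ⟨⟨i, hi.1⟩, mem_bitSet.2 hi.2⟩
  · intro b hb hsub
    have hsub' : (bitSet b).erase v ⊆ F := Finset.subset_insert_iff.1 hsub
    by_cases hvb : v ∈ bitSet b
    · rcases hB b hb with h | ⟨c, hc, hcb⟩
      · rw [mem_bitSet, h] at hvb
        exact absurd hvb (by simp)
      · refine hF.2 c hc ((bitSet_subset_of_land_eq hcb).trans ?_)
        rw [bitSet_lor, bitSet_xor_two_pow hvb]
        exact Finset.union_subset hsF hsub'
    · rw [Finset.erase_eq_of_notMem hvb] at hsub'
      exact hF.2 b hb hsub'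
  · ext F
    simp only [avoidingComplex, List.forall_mem_cons, Set.mem_ofPred_eq]
    tauto

/-- The pairs in `L` are the successive open stars and apices of a reduction. -/
def checkStarCollapses : List ℕ → List (ℕ × Fin 20) → Bool
  | _, [] => true
  | B, (s, v) :: L => checkStarCollapse B s v && checkStarCollapses (s :: B) L

theorem starCollapses_of_check {L : List (ℕ × Fin 20)} {B : List ℕ}
    (h : checkStarCollapses B L = true) :
    StarCollapses (avoidingComplex B) (avoidingComplex ((L.map Prod.fst).reverse ++ B)) := by
  induction L generalizing B with
  | nil => exact StarCollapses.refl _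
  | cons p L ih =>
    obtain ⟨s, v⟩ := p
    rw [checkStarCollapses, Bool.and_eq_true] at h
    have := ih h.2
    rw [List.map_cons, List.reverse_cons, List.append_assoc]
    exact StarCollapses.step _ _ (isStarCollapse_of_check h.1) this

/-! ### The reduction for the dodecahedron -/

/-- The pairs of vertices of distance at least four. -/
def farPairs : List ℕ :=
  [24, 36, 66, 129, 264, 384, 516, 576, 768, 1026, 1056, 1536, 2049, 2064, 2304, 3072, 4160,
    4224, 8208, 8224, 12288, 16388, 16392, 24576, 32769, 32770, 36864, 49152, 65568, 65664,
    131088, 131136, 262146, 262152, 327680, 393216, 524289, 524292, 589824, 655360]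

/-- The sets of four vertices of pairwise distance three. -/
def tetrahedra : List ℕ :=
  [105, 270849, 150, 532738, 268292, 529416, 98832, 164128, 84032, 148608]

/-- The stars that are removed to pass from diameter three to diameter two, with their apices. -/
def starSequence : List (ℕ × Fin 20) :=
  [(18434, 9), (8322, 3), (104, 7), (40, 9), (72, 13), (96, 18), (33, 12), (65, 8), (9, 16),
    (16464, 10), (84, 10), (528400, 14), (528640, 14), (134, 3), (130, 9), (144, 18), (132, 13),
    (6, 16), (18, 14), (20, 8), (34880, 13), (262657, 4), (513, 16), (8193, 8), (262145, 8),
    (8704, 11), (262656, 5), (266272, 14), (98320, 6), (32784, 19), (33280, 11), (98304, 2),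
    (66048, 12), (528, 5), (65552, 8), (264196, 13), (262148, 8), (270336, 19), (264192, 19),
    (4100, 16), (2052, 13), (266240, 10), (1036, 13), (18496, 7), (16448, 10), (65600, 13),
    (2112, 7), (81920, 12), (18432, 5), (67584, 1), (6144, 1), (33056, 18), (33024, 10),
    (288, 14), (32800, 7), (131104, 9), (163840, 13), (259, 12), (5136, 0), (5128, 16),
    (1032, 13), (4104, 1), (528384, 14), (5120, 0), (524296, 11), (278656, 19), (16544, 9),
    (524560, 10), (524802, 5), (8202, 17), (147584, 9), (16512, 19), (133248, 3), (131712, 3),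
    (131200, 13), (1152, 6), (132096, 8), (147456, 12), (131328, 16), (533504, 6), (525312, 18),
    (17408, 4), (532608, 15), (9472, 2), (532736, 6), (532544, 15), (532480, 11), (10242, 17),
    (8194, 16), (8448, 2), (524608, 18), (524544, 14), (524290, 5), (258, 12)]

theorem checkStarCollapses_starSequence :
    checkStarCollapses (tetrahedra ++ farPairs) starSequence = true := by
  decide +kernel

theorem combDiam_dodecahedronGraph_le_iff (F : Finset (Fin 20)) (r : ℕ) :
    combDiam dodecahedronGraph F ≤ r ↔ ∀ i ∈ F, ∀ j ∈ F, dodecahedronDist i j ≤ r := by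
  simp [combDiam, Finset.sup_le_iff, dodecahedronGraph_edist]

theorem mem_vietorisRips_iff (F : Finset (Fin 20)) (r : ℕ) :
    F ∈ (vietorisRips dodecahedronGraph r).faces ↔
      F.Nonempty ∧ ∀ i ∈ F, ∀ j ∈ F, dodecahedronDist i j ≤ r :=
  and_congr_right fun _ => combDiam_dodecahedronGraph_le_iff F r

theorem mem_distanceThreeTetrahedra_iff (F : Finset (Fin 20)) :
    F ∈ distanceThreeTetrahedra ↔ F ∈ (tetrahedra.map bitSet).toFinset := by
  -- Hypotheses and quantifiers alternate so that the evaluation discards a partial choice as soon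
  -- as a distance is wrong.
  have hlist : ∀ a b, dodecahedronDist a b = 3 → ∀ c, dodecahedronDist a c = 3 →
      dodecahedronDist b c = 3 → ∀ d, dodecahedronDist a d = 3 → dodecahedronDist b d = 3 →
      dodecahedronDist c d = 3 → ({a, b, c, d} : Finset (Fin 20)) ∈ tetrahedra.map bitSet := by
    decide +kernel
  have hmem : ∀ m ∈ tetrahedra, (bitSet m).card = 4 ∧
      ∀ u ∈ bitSet m, ∀ v ∈ bitSet m, u ≠ v → dodecahedronDist u v = 3 := by
    decide +kernel
  have hdist : ∀ u v, dodecahedronGraph.edist u v = 3 ↔ dodecahedronDist u v = 3 := by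
    intro u v
    rw [dodecahedronGraph_edist]
    norm_cast
  rw [List.mem_toFinset]
  constructor
  · rintro ⟨hcard, h⟩
    simp only [hdist] at h
    obtain ⟨a, b, c, d, hab, hac, had, hbc, hbd, hcd, rfl⟩ := Finset.card_eq_four.1 hcard
    exact hlist a b (h _ (by simp) _ (by simp) hab) c (h _ (by simp) _ (by simp) hac)
      (h _ (by simp) _ (by simp) hbc) d (h _ (by simp) _ (by simp) had)
      (h _ (by simp) _ (by simp) hbd) (h _ (by simp) _ (by simp) hcd)
  · intro h
    obtain ⟨m, hm, rfl⟩ := List.mem_map.1 h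
    refine ⟨(hmem m hm).1, ?_⟩
    simp only [hdist]
    exact (hmem m hm).2

theorem ncard_distanceThreeTetrahedra : distanceThreeTetrahedra.ncard = 10 := by
  have : distanceThreeTetrahedra = ((tetrahedra.map bitSet).toFinset : Set (Finset (Fin 20))) := by
    ext F
    rw [mem_distanceThreeTetrahedra_iff, Finset.mem_coe]
  rw [this, Set.ncard_coe_finset]
  decide +kernel

theorem avoidingComplex_faces_eq_diff :
    (avoidingComplex (tetrahedra ++ farPairs)).faces =
      (vietorisRips dodecahedronGraph 3).faces \ distanceThreeTetrahedra := by
  have hfar : ∀ m ∈ farPairs, ∃ i ∈ bitSet m, ∃ j ∈ bitSet m, 3 < dodecahedronDist i j := by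
    decide +kernel
  have hpair : ∀ i j, 3 < dodecahedronDist i j → ∃ m ∈ farPairs, bitSet m = {i, j} := by
    decide +kernel
  -- The tetrahedra are maximal simplices, so for simplices of diameter at most three, containing
  -- one means being equal to it.
  have hmax : ∀ m ∈ tetrahedra, ∀ i, i ∉ bitSet m → ∃ j ∈ bitSet m, 3 < dodecahedronDist i j := by
    decide +kernel
  ext F
  rw [Set.mem_sdiff, mem_vietorisRips_iff, mem_distanceThreeTetrahedra_iff, List.mem_toFinset,
    List.mem_map]
  constructor
  · rintro ⟨hne, hF⟩
    refine ⟨⟨hne, fun i hi j hj => ?_⟩, ?_⟩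
    · by_contra! hij
      obtain ⟨m, hm, he⟩ := hpair i j hij
      refine hF m (List.mem_append_right _ hm) ?_
      rw [he, Finset.insert_subset_iff, Finset.singleton_subset_iff]
      exact ⟨hi, hj⟩
    · rintro ⟨m, hm, rfl⟩
      exact hF m (List.mem_append_left _ hm) subset_rfl
  · rintro ⟨⟨hne, hF⟩, ht⟩
    refine ⟨hne, fun m hm hsub => ?_⟩
    rcases List.mem_append.1 hm with hm | hm
    · refine ht ⟨m, hm, hsub.antisymm fun i hi => ?_⟩
      by_contra him
      obtain ⟨j, hj, hij⟩ := hmax m hm i him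
      exact absurd (hF i hi j (hsub hj)) (by omega)
    · obtain ⟨i, hi, j, hj, hij⟩ := hfar m hm
      exact absurd (hF i (hsub hi) j (hsub hj)) (by omega)

/-- The removed stars include those of all pairs at distance three. The larger sets removed along
the way contain a pair at distance greater than two, so they impose no further condition at the end.
-/
theorem avoidingComplex_eq_vietorisRips_two :
    avoidingComplex ((starSequence.map Prod.fst).reverse ++ (tetrahedra ++ farPairs)) =
      vietorisRips dodecahedronGraph 2 := by
  have hfar : ∀ m ∈ (starSequence.map Prod.fst).reverse ++ (tetrahedra ++ farPairs),
      ∃ i ∈ bitSet m, ∃ j ∈ bitSet m, 2 < dodecahedronDist i j := by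
    decide +kernel
  have hpair : ∀ i j, 2 < dodecahedronDist i j →
      ∃ m ∈ (starSequence.map Prod.fst).reverse ++ (tetrahedra ++ farPairs),
        bitSet m = {i, j} := by
    decide +kernel
  ext F
  rw [mem_vietorisRips_iff]
  refine and_congr_right fun _ => ⟨fun hF i hi j hj => ?_, fun hF m hm hsub => ?_⟩
  · by_contra! hij
    obtain ⟨m, hm, he⟩ := hpair i j hij
    refine hF m hm ?_
    rw [he, Finset.insert_subset_iff, Finset.singleton_subset_iff]
    exact ⟨hi, hj⟩
  · obtain ⟨i, hi, j, hj, hij⟩ := hfar m hm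
    exact absurd (hF i (hsub hi) j (hsub hj)) (by omega)

theorem starCollapses_dodecahedron :
    StarCollapses (avoidingComplex (tetrahedra ++ farPairs))
      (vietorisRips dodecahedronGraph 2) := by
  rw [← avoidingComplex_eq_vietorisRips_two]
  exact starCollapses_of_check checkStarCollapses_starSequence

/-! ### Return to the full complex of diameter three -/

theorem combDiam_eq_three_iff (F : Finset (Fin 20)) :
    combDiam dodecahedronGraph F = 3 ↔
      combDiam dodecahedronGraph F ≤ (3 : ℕ) ∧ ¬ combDiam dodecahedronGraph F ≤ (2 : ℕ) := by
  generalize combDiam dodecahedronGraph F = d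
  induction d using ENat.recTopCoe with
  | top => simp
  | coe n =>
    norm_cast
    omega

theorem combDiam_of_mem_distanceThreeTetrahedra {F : Finset (Fin 20)}
    (hF : F ∈ distanceThreeTetrahedra) :
    F ∈ (vietorisRips dodecahedronGraph 3).faces ∧ combDiam dodecahedronGraph F = 3 := by
  have hmem : ∀ m ∈ tetrahedra, (bitSet m).Nonempty ∧
      (∀ u ∈ bitSet m, ∀ v ∈ bitSet m, dodecahedronDist u v ≤ 3) ∧
      ¬ ∀ u ∈ bitSet m, ∀ v ∈ bitSet m, dodecahedronDist u v ≤ 2 := by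
    decide +kernel
  rw [mem_distanceThreeTetrahedra_iff, List.mem_toFinset, List.mem_map] at hF
  obtain ⟨m, hm, rfl⟩ := hF
  obtain ⟨h1, h2, h3⟩ := hmem m hm
  rw [mem_vietorisRips_iff, combDiam_eq_three_iff, combDiam_dodecahedronGraph_le_iff,
    combDiam_dodecahedronGraph_le_iff]
  exact ⟨⟨h1, h2⟩, h2, h3⟩

theorem mainTheorem2 :
    distanceThreeTetrahedra.ncard = 10 ∧
    (∃ M : Finset (Fin 20) → Finset (Fin 20) → Prop,
      IsPartialMatching (vietorisRips dodecahedronGraph 3) M ∧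
      IsAcyclicMatching (vietorisRips dodecahedronGraph 3) M ∧
      (∀ σ, IsMatched M σ → combDiam dodecahedronGraph σ = 3) ∧
      {σ | σ ∈ (vietorisRips dodecahedronGraph 3).faces ∧
          combDiam dodecahedronGraph σ = 3 ∧ ¬ IsMatched M σ} = distanceThreeTetrahedra) ∧
    (∃ Y : PreAbstractSimplicialComplex (Fin 20),
      Y.faces = (vietorisRips dodecahedronGraph 3).faces \ distanceThreeTetrahedra ∧
      StronglyDeformationRetracts (realization Y)
        (realization (vietorisRips dodecahedronGraph 2))) := by
  refine ⟨ncard_distanceThreeTetrahedra, ?_, avoidingComplex (tetrahedra ++ farPairs),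
    avoidingComplex_faces_eq_diff, starCollapses_dodecahedron.stronglyDeformationRetracts⟩
  obtain ⟨-, M, f, hM, hf, hmatch⟩ := starCollapses_dodecahedron.exists_matching
  rw [avoidingComplex_faces_eq_diff] at hmatch
  have hsub : (avoidingComplex (tetrahedra ++ farPairs)).faces ⊆
      (vietorisRips dodecahedronGraph 3).faces := by
    rw [avoidingComplex_faces_eq_diff]
    exact Set.sdiff_subset
  have hbot : IsPartialMatching (vietorisRips dodecahedronGraph 3) fun _ _ => False :=
    ⟨by simp, by simp, by simp, by simp⟩
  -- The tetrahedra are added back with the empty matching. Outside the smaller complex every step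
  -- then goes down, and cardinality is a potential.
  obtain ⟨g, hg⟩ := exists_potential_union (K := vietorisRips dodecahedronGraph 3)
    (N := fun _ _ => False) (g := Finset.card) hM (by simp) hf (by
      rintro a b - - ⟨-, -, ⟨-, h⟩ | ⟨h, -⟩⟩
      · exact h.elim
      · have := h.2
        omega)
  have hM' := hM.union hsub hbot (by simp)
  simp only [or_false] at hg hM'
  have hdiam : ∀ σ, σ ∈ (vietorisRips dodecahedronGraph 3).faces →
      (combDiam dodecahedronGraph σ = 3 ↔ σ ∉ (vietorisRips dodecahedronGraph 2).faces) := by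
    intro σ hσ
    rw [combDiam_eq_three_iff]
    exact ⟨fun h hσ' => h.2 hσ'.2, fun h => ⟨hσ.2, fun hle => h ⟨hσ.1, hle⟩⟩⟩
  refine ⟨M, hM', isAcyclicMatching_of_potential hg, fun σ hσ => ?_, ?_⟩
  · obtain ⟨h1, h2⟩ := (hmatch σ).1 hσ
    exact (hdiam σ h1.1).2 h2
  · ext σ
    constructor
    · rintro ⟨h1, h2, h3⟩
      by_contra hσ
      exact h3 ((hmatch σ).2 ⟨⟨h1, hσ⟩, (hdiam σ h1).1 h2⟩)
    · intro hσ
      obtain ⟨h1, h2⟩ := combDiam_of_mem_distanceThreeTetrahedra hσ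
      exact ⟨h1, h2, fun h => ((hmatch σ).1 h).1.2 hσ⟩
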